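/- Let $\mathbb{K}$ be a field of characteristic zero, and let $m,n\ge 1$ be integers with $m+n\le 5$. Let $K_{m,n}$ be the complete bipartite graph, with edges $1,\dots,N$ where $N=mn$, and let $$F=\sum_{T}\prod_{e\in E(T)}x_e\in\mathbb{K}[x_1,\dots,x_N]$$ be its Kirchhoff polynomial, where $T$ runs over the spanning trees of $K_{m,n}$. Put $$\operatorname{Ann}(F)=\Big\{P\in\mathbb{K}[x_1,\dots,x_N] : P\Big(\tfrac{\partial}{\partial x_1},\dots,\tfrac{\partial}{\partial x_N}\Big)F=0\Big\},\qquad A_{M(K_{m,n})}=\mathbb{K}[x_1,\dots,x_N]/\operatorname{Ann}(F),$$ where the homogeneous component of degree $k$ of $A_{M(K_{m,n})}$ is the set of classes of the homogeneous polynomials of degree $k$. A graded Artinian algebra $A=\bigoplus_{k=0}^{s}A_k$ with $A_s\neq 0$ is said to have the strong Lefschetz property if there is an element $L\in A_1$ such that the multiplication map $\times L^{s-2k}\colon A_k\to A_{s-k}$ is bijective for all integers $0\le k\le s/2$; such an $L$ is called a strong Lefschetz element. Then $A_{M(K_{m,n})}$ is a graded Artinian algebra which has the strong Lefschetz property, and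 (the class of) $x_1+\cdots+x_N$ is a strong Lefschetz element of it. -/

import Mathlib

open MvPolynomial

noncomputable section

/-- The partial derivatives `∂/∂x_i` and `∂/∂x_j` commute as linear operators. -/
theorem pderiv_comp_comm {σ K : Type*} [Field K] (i j : σ) :
    (pderiv i : Derivation K (MvPolynomial σ K) (MvPolynomial σ K)).toLinearMap *
        (pderiv j : Derivation K (MvPolynomial σ K) (MvPolynomial σ K)).toLinearMap =
      (pderiv j : Derivation K (MvPolynomial σ K) (MvPolynomial σ K)).toLinearMap *
        (pderiv i : Derivation K (MvPolynomial σ K) (MvPolynomial σ K)).toLinearMap := by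
  classical
  have h : ⁅(pderiv i : Derivation K (MvPolynomial σ K) (MvPolynomial σ K)),
      (pderiv j : Derivation K (MvPolynomial σ K) (MvPolynomial σ K))⁆ = 0 := by
    apply MvPolynomial.derivation_ext
    intro k
    by_cases hi : i = k <;> by_cases hj : j = k <;>
      simp [Derivation.commutator_apply, pderiv_X, hi, hj]
  refine LinearMap.ext fun p => ?_
  have := DFunLike.congr_fun h p
  rw [Derivation.commutator_apply] at this
  exact sub_eq_zero.mp this

open scoped IsMulCommutative in
/-- The substitution `P ↦ P(∂/∂x_i : i ∈ σ)`, as the `K`-algebra homomorphism from `K[x_i : i ∈ σ]`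
to the linear operators on `K[x_i : i ∈ σ]` which sends `x_i` to `∂/∂x_i` (see `diffOp_X`). -/
def diffOp (σ K : Type*) [Field K] :
    MvPolynomial σ K →ₐ[K] Module.End K (MvPolynomial σ K) :=
  let D : σ → Module.End K (MvPolynomial σ K) := fun i => (pderiv i).toLinearMap
  let S : Subalgebra K (Module.End K (MvPolynomial σ K)) := Algebra.adjoin K (Set.range D)
  haveI : IsMulCommutative S := Algebra.isMulCommutative_adjoin K (by
    rintro _ ⟨i, rfl⟩ _ ⟨j, rfl⟩
    exact pderiv_comp_comm i j)
  S.val.comp (aeval fun i => (⟨D i, Algebra.subset_adjoin ⟨i, rfl⟩⟩ : S))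

theorem diffOp_X {σ K : Type*} [Field K] (i : σ) :
    diffOp σ K (X i) = (pderiv i).toLinearMap := by
  simp [diffOp]

/-- `Ann(F)`, the ideal of all `P` with `P(∂/∂x_i : i ∈ σ) F = 0`. -/
def annIdeal {σ K : Type*} [Field K] (F : MvPolynomial σ K) : Ideal (MvPolynomial σ K) where
  carrier := {P | diffOp σ K P F = 0}
  zero_mem' := by simp
  add_mem' := by
    intro P Q hP hQ
    simp only [Set.mem_ofPred_eq] at hP hQ ⊢
    simp [hP, hQ]
  smul_mem' := by
    intro P Q hQ
    simp only [Set.mem_ofPred_eq] at hQ ⊢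
    simp [hQ]

open Classical in
/-- The Kirchhoff polynomial `∑_T ∏_{e ∈ E(T)} x_e` of a graph, the sum running over its spanning
trees `T`; each spanning tree is given by its set of edges. -/
def kirchhoffPolynomial {V : Type*} (K : Type*) [Field K] (Γ : SimpleGraph V)
    [Fintype Γ.edgeSet] : MvPolynomial Γ.edgeSet K :=
  ∑ T : Finset Γ.edgeSet with
      (SimpleGraph.fromEdgeSet (Subtype.val '' (T : Set Γ.edgeSet))).IsTree,
    ∏ e ∈ T, X e

/-- The algebra `A_{M(Γ)} = K[x_e : e ∈ E(Γ)] / Ann(F_Γ)` of the graphic matroid of `Γ`. -/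
abbrev graphicAlgebra {V : Type*} (K : Type*) [Field K] (Γ : SimpleGraph V)
    [Fintype Γ.edgeSet] : Type _ :=
  MvPolynomial Γ.edgeSet K ⧸ annIdeal (kirchhoffPolynomial K Γ)

/-- The homogeneous component of degree `k` of `A_{M(Γ)}`: the classes of the homogeneous
polynomials of degree `k`. -/
def graphicComponent {V : Type*} (K : Type*) [Field K] (Γ : SimpleGraph V)
    [Fintype Γ.edgeSet] (k : ℕ) : Submodule K (graphicAlgebra K Γ) :=
  (homogeneousSubmodule Γ.edgeSet K k).map
    (Ideal.Quotient.mkₐ K (annIdeal (kirchhoffPolynomial K Γ))).toLinearMap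

/-- `A` is an Artinian algebra, graded by `A = ⨁_{k=0}^{s} A_k` with `A_s ≠ 0`. -/
structure IsGradedArtinian {K A : Type*} [Field K] [CommRing A] [Algebra K A]
    (𝒜 : ℕ → Submodule K A) (s : ℕ) : Prop where
  isArtinianRing : IsArtinianRing A
  gradedMonoid : SetLike.GradedMonoid 𝒜
  isInternal : DirectSum.IsInternal 𝒜
  top_ne_bot : 𝒜 s ≠ ⊥
  eq_bot_of_lt : ∀ k, s < k → 𝒜 k = ⊥

/-- `L` is a strong Lefschetz element of the graded Artinian algebra `A = ⨁_{k=0}^{s} A_k`: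
it lies in `A_1`, and `×L^{s-2k} : A_k → A_{s-k}` is bijective for all `k ≤ s/2`. -/
def IsStrongLefschetzElement {K A : Type*} [Field K] [CommRing A] [Algebra K A]
    (𝒜 : ℕ → Submodule K A) (L : A) : Prop :=
  ∃ s : ℕ, IsGradedArtinian 𝒜 s ∧ L ∈ 𝒜 1 ∧
    ∀ k : ℕ, 2 * k ≤ s →
      Set.BijOn (fun a : A => L ^ (s - 2 * k) * a) (𝒜 k : Set A) (𝒜 (s - k) : Set A)

/-- The strong Lefschetz property of a graded Artinian algebra. -/
def HasStrongLefschetzProperty {K A : Type*} [Field K] [CommRing A] [Algebra K A]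
    (𝒜 : ℕ → Submodule K A) : Prop :=
  ∃ L : A, IsStrongLefschetzElement 𝒜 L

end

/-!
Differentiating `F` identifies the elements of degree `k` of `K[x] / Ann(F)` with polynomials of
degree `s - k`, and by Euler's formula `(∑ a_i x_i)^k` acts on forms of degree `k` as `k!` times the
evaluation at `a`. If `s ≤ 4`, the strong Lefschetz property therefore only requires that `F` and,
for `s ≥ 3`, the Hessian determinant of `F` do not vanish at `a`.

By the weighted matrix-tree theorem, the Kirchhoff polynomial is `F(w) = det (Bᵀ * diag w * B)` for
a reduced incidence matrix `B`. Its Hessian at `(1, …, 1)` is `F(1, …, 1)` times the matrix of the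
principal `2 × 2` minors of the orthogonal projection `P` onto the column space of `B`. This matrix
is nonsingular over `ℚ`, because `P` has rank `|V| - 1 ≠ 1` and a weighted Laplacian determines its
weights.
-/

open scoped Matrix

section GradedQuotient

open DirectSum

variable {R A : Type*} [CommRing R] [CommRing A] [Algebra R A]

/-- The homogeneous component of degree `i` of `A ⧸ I`, for an algebra `A` with components `𝒜`: the
classes of the elements of `𝒜 i`. -/
def quotientComponent {ι : Type*} (𝒜 : ι → Submodule R A) (I : Ideal A) (i : ι) :
    Submodule R (A ⧸ I) :=
  (𝒜 i).map (Ideal.Quotient.mkₐ R I).toLinearMap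

theorem mem_quotientComponent {ι : Type*} {𝒜 : ι → Submodule R A} {I : Ideal A} {i : ι}
    {x : A ⧸ I} : x ∈ quotientComponent 𝒜 I i ↔ ∃ a ∈ 𝒜 i, Ideal.Quotient.mk I a = x :=
  Iff.rfl

theorem mk_mem_quotientComponent {ι : Type*} {𝒜 : ι → Submodule R A} (I : Ideal A) {i : ι} {a : A}
    (ha : a ∈ 𝒜 i) : Ideal.Quotient.mk I a ∈ quotientComponent 𝒜 I i :=
  ⟨a, ha, rfl⟩

section GradedAlgebra

variable {ι : Type*} [DecidableEq ι] [AddMonoid ι] {𝒜 : ι → Submodule R A} [GradedAlgebra 𝒜]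

theorem gradedMonoid_quotientComponent (I : Ideal A) :
    SetLike.GradedMonoid (quotientComponent 𝒜 I) where
  one_mem := mk_mem_quotientComponent I (SetLike.GradedOne.one_mem (A := 𝒜))
  mul_mem := by
    rintro i j _ _ ⟨a, ha, rfl⟩ ⟨b, hb, rfl⟩
    exact mk_mem_quotientComponent I (SetLike.GradedMul.mul_mem ha hb)

theorem iSup_quotientComponent (I : Ideal A) : ⨆ i, quotientComponent 𝒜 I i = ⊤ := by
  unfold quotientComponent
  rw [← Submodule.map_iSup, (Decomposition.isInternal 𝒜).submodule_iSup_eq_top, Submodule.map_top,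
    LinearMap.range_eq_top]
  exact Ideal.Quotient.mk_surjective

theorem iSupIndep_quotientComponent {I : Ideal A} (hI : I.IsHomogeneous 𝒜) :
    iSupIndep (quotientComponent 𝒜 I) := by
  classical
  refine iSupIndep_of_dfinsupp_lsum_injective _ ((injective_iff_map_eq_zero _).mpr fun x hx => ?_)
  choose a ha hax using fun i => mem_quotientComponent.mp (x i).2
  have hsum : ∑ i ∈ x.support, a i ∈ I := by
    rw [DFinsupp.lsum_apply_apply, DFinsupp.sumAddHom_apply, DFinsupp.sum] at hx
    rw [← Ideal.Quotient.eq_zero_iff_mem, map_sum, ← hx]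
    exact Finset.sum_congr rfl fun i _ => hax i
  ext i
  by_cases hi : i ∈ x.support
  · have hcomponent : (decompose 𝒜 (∑ j ∈ x.support, a j) i : A) = a i := by
      rw [decompose_sum, DFinsupp.finsetSum_apply, AddSubmonoidClass.coe_finsetSum,
        Finset.sum_eq_single_of_mem i hi fun j _ hji => decompose_of_mem_ne 𝒜 (ha j) hji,
        decompose_of_mem_same 𝒜 (ha i)]
    have hai : a i ∈ I := hcomponent ▸ hI i hsum
    rw [← hax i, Ideal.Quotient.eq_zero_iff_mem.mpr hai, DFinsupp.zero_apply, ZeroMemClass.coe_zero]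
  · rw [DFinsupp.notMem_support_iff.mp hi, DFinsupp.zero_apply]

end GradedAlgebra

theorem finite_quotient_of_quotientComponent_eq_bot {𝒜 : ℕ → Submodule R A} [GradedAlgebra 𝒜]
    (hfg : ∀ k, (𝒜 k).FG) {I : Ideal A} {s : ℕ} (hbot : ∀ k, s < k → quotientComponent 𝒜 I k = ⊥) :
    Module.Finite R (A ⧸ I) := by
  have htop : ⨆ k ∈ Finset.range (s + 1), quotientComponent 𝒜 I k = ⊤ := by
    rw [eq_top_iff, ← iSup_quotientComponent (𝒜 := 𝒜) I]
    refine iSup_le fun k => ?_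
    rcases lt_or_ge s k with hk | hk
    · exact (hbot k hk).le.trans bot_le
    · exact le_iSup₂_of_le k (Finset.mem_range_succ_iff.mpr hk) le_rfl
  rw [Module.finite_def, ← htop]
  exact Submodule.fg_biSup _ _ fun k _ => (hfg k).map _

theorem isGradedArtinian_quotientComponent {K A : Type*} [Field K] [CommRing A] [Algebra K A]
    {𝒜 : ℕ → Submodule K A} [GradedAlgebra 𝒜] (hfg : ∀ k, (𝒜 k).FG) {I : Ideal A}
    (hI : I.IsHomogeneous 𝒜) {s : ℕ} (htop : quotientComponent 𝒜 I s ≠ ⊥)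
    (hbot : ∀ k, s < k → quotientComponent 𝒜 I k = ⊥) :
    IsGradedArtinian (quotientComponent 𝒜 I) s where
  isArtinianRing :=
    have := finite_quotient_of_quotientComponent_eq_bot hfg hbot
    IsArtinianRing.of_finite K _
  gradedMonoid := gradedMonoid_quotientComponent I
  isInternal := isInternal_submodule_of_iSupIndep_of_iSup_eq_top
    (iSupIndep_quotientComponent hI) (iSup_quotientComponent I)
  top_ne_bot := htop
  eq_bot_of_lt := hbot

end GradedQuotient

section AnnihilatorAlgebra

variable {σ K : Type*} [Field K] {F P : MvPolynomial σ K} {s k : ℕ}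

theorem mem_annIdeal : P ∈ annIdeal F ↔ diffOp σ K P F = 0 := Iff.rfl

theorem diffOp_X_apply (i : σ) (F : MvPolynomial σ K) : diffOp σ K (X i) F = pderiv i F := by
  rw [diffOp_X]
  rfl

theorem exists_eq_C_of_isHomogeneous_zero (hP : P.IsHomogeneous 0) : ∃ c, P = C c :=
  ⟨_, totalDegree_eq_zero_iff_eq_C.mp ((totalDegree_zero_iff_isHomogeneous σ).mpr hP)⟩

theorem isHomogeneous_diffOp_of_isHomogeneous_one (hF : F.IsHomogeneous s)
    (hP : P.IsHomogeneous 1) : (diffOp σ K P F).IsHomogeneous (s - 1) := by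
  rw [← mem_homogeneousSubmodule, homogeneousSubmodule_one_eq_span_X] at hP
  induction hP using Submodule.span_induction with
  | mem _ hX =>
    obtain ⟨i, rfl⟩ := hX
    exact diffOp_X_apply i F ▸ hF.pderiv
  | zero => simpa using isHomogeneous_zero σ K _
  | add P Q _ _ hP hQ => simpa using hP.add hQ
  | smul c P _ hP => simpa using (homogeneousSubmodule σ K _).smul_mem c hP

theorem isHomogeneous_diffOp (hF : F.IsHomogeneous s) (hP : P.IsHomogeneous k) :
    (diffOp σ K P F).IsHomogeneous (s - k) := by
  rw [← mem_homogeneousSubmodule, ← homogeneousSubmodule_one_pow] at hP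
  induction hP using Submodule.pow_induction_on_left' with
  | algebraMap c => simpa using (homogeneousSubmodule σ K s).smul_mem c hF
  | add P Q _ _ _ hP hQ => simpa using hP.add hQ
  | mem_mul L hL k P _ hP =>
    rw [map_mul, Module.End.mul_apply, Nat.succ_eq_add_one, ← Nat.sub_sub]
    exact isHomogeneous_diffOp_of_isHomogeneous_one hP hL

theorem diffOp_C_eq_zero_of_isHomogeneous_one (hP : P.IsHomogeneous 1) (c : K) :
    diffOp σ K P (C c) = 0 := by
  rw [← mem_homogeneousSubmodule, homogeneousSubmodule_one_eq_span_X] at hP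
  induction hP using Submodule.span_induction with
  | mem _ hX =>
    obtain ⟨i, rfl⟩ := hX
    rw [diffOp_X_apply, pderiv_C]
  | zero => simp
  | add P Q _ _ hP hQ => simp [hP, hQ]
  | smul c P _ hP => simp [hP]

theorem diffOp_eq_zero_of_lt (hF : F.IsHomogeneous s) (hP : P.IsHomogeneous k) (hsk : s < k) :
    diffOp σ K P F = 0 := by
  rw [← mem_homogeneousSubmodule, ← homogeneousSubmodule_one_pow] at hP
  induction hP using Submodule.pow_induction_on_left' with
  | algebraMap c => exact absurd hsk s.not_lt_zero
  | add P Q _ _ _ hP hQ => rw [map_add, LinearMap.add_apply, hP hsk, hQ hsk, add_zero]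
  | mem_mul L hL k P hP _ =>
    have hPF : (diffOp σ K P F).IsHomogeneous 0 := by
      rw [homogeneousSubmodule_one_pow] at hP
      simpa [Nat.sub_eq_zero_of_le (Nat.lt_succ_iff.mp hsk)] using isHomogeneous_diffOp hF hP
    obtain ⟨c, hc⟩ := exists_eq_C_of_isHomogeneous_zero hPF
    rw [map_mul, Module.End.mul_apply, hc]
    exact diffOp_C_eq_zero_of_isHomogeneous_one hL _

theorem homogeneousComponent_diffOp (hF : F.IsHomogeneous s) (P : MvPolynomial σ K) {i : ℕ}
    (hi : i ≤ s) :
    homogeneousComponent (s - i) (diffOp σ K P F) = diffOp σ K (homogeneousComponent i P) F := by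
  have hcomponent (j : ℕ) :
      homogeneousComponent (s - i) (diffOp σ K (homogeneousComponent j P) F) =
        if j = i then diffOp σ K (homogeneousComponent i P) F else 0 := by
    have hj := isHomogeneous_diffOp hF (homogeneousComponent_isHomogeneous j P)
    split_ifs with hji
    · rw [← hji, homogeneousComponent_of_mem hj, if_pos rfl]
    · rcases lt_or_ge s j with hsj | hjs
      · rw [diffOp_eq_zero_of_lt hF (homogeneousComponent_isHomogeneous j P) hsj, map_zero]
      · rw [homogeneousComponent_of_mem hj, if_neg (by omega)]
  conv_lhs => rw [← sum_homogeneousComponent P]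
  simp only [map_sum, LinearMap.sum_apply, hcomponent, Finset.sum_ite_eq', Finset.mem_range]
  split_ifs with hiP
  · rfl
  · rw [homogeneousComponent_eq_zero _ _ (by omega), map_zero, LinearMap.zero_apply]

attribute [local instance] MvPolynomial.gradedAlgebra

theorem isHomogeneous_annIdeal (hF : F.IsHomogeneous s) :
    (annIdeal F).IsHomogeneous (homogeneousSubmodule σ K) := by
  intro i P hP
  have hdecompose : (DirectSum.decompose (homogeneousSubmodule σ K) P i : MvPolynomial σ K) =
      homogeneousComponent i P := decomposition.decompose'_apply P i
  rw [hdecompose, mem_annIdeal]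
  rcases lt_or_ge s i with hsi | his
  · exact diffOp_eq_zero_of_lt hF (homogeneousComponent_isHomogeneous i P) hsi
  · rw [← homogeneousComponent_diffOp hF P his, mem_annIdeal.mp hP, map_zero]

/-- The homogeneous component of degree `k` of the Gorenstein algebra `K[x_i : i ∈ σ] / Ann(F)`. -/
noncomputable def apolarComponent (F : MvPolynomial σ K) :
    ℕ → Submodule K (MvPolynomial σ K ⧸ annIdeal F) :=
  quotientComponent (homogeneousSubmodule σ K) (annIdeal F)

theorem apolarComponent_eq_bot (hF : F.IsHomogeneous s) (hsk : s < k) :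
    apolarComponent F k = ⊥ := by
  rw [eq_bot_iff]
  rintro _ ⟨P, hP, rfl⟩
  exact Ideal.Quotient.eq_zero_iff_mem.mpr (diffOp_eq_zero_of_lt hF hP hsk)

theorem isGradedArtinian_apolarComponent [Finite σ] (hF : F.IsHomogeneous s)
    (htop : apolarComponent F s ≠ ⊥) : IsGradedArtinian (apolarComponent F) s :=
  isGradedArtinian_quotientComponent (homogeneousSubmodule_fg σ K) (isHomogeneous_annIdeal hF) htop
    fun _ => apolarComponent_eq_bot hF

end AnnihilatorAlgebra

section Lefschetz

variable {σ K : Type*} [Field K] {F G L P : MvPolynomial σ K} {s k : ℕ}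

theorem exists_diffOp_mul_eq_of_injective [Finite σ] {M : MvPolynomial σ K} {d : ℕ}
    (hF : F.IsHomogeneous (2 * k + d)) (hM : M.IsHomogeneous d)
    (hinj : ∀ P : MvPolynomial σ K, P.IsHomogeneous k → diffOp σ K (M * P) F = 0 → P = 0)
    (hG : G.IsHomogeneous k) :
    ∃ P : MvPolynomial σ K, P.IsHomogeneous k ∧ diffOp σ K (M * P) F = G := by
  have : Module.Finite K (homogeneousSubmodule σ K k) :=
    Module.Finite.iff_fg.mpr (homogeneousSubmodule_fg σ K k)
  have hdegree (P : MvPolynomial σ K) (hP : P.IsHomogeneous k) :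
      (diffOp σ K (M * P) F).IsHomogeneous k := by
    simpa [show 2 * k + d - (d + k) = k by omega] using isHomogeneous_diffOp hF (hM.mul hP)
  let T : Module.End K (homogeneousSubmodule σ K k) :=
    LinearMap.restrict (LinearMap.applyₗ F ∘ₗ (diffOp σ K).toLinearMap ∘ₗ LinearMap.mulLeft K M)
      hdegree
  have hT : Function.Injective T := (injective_iff_map_eq_zero T).mpr fun P hP =>
    Subtype.ext (hinj P P.2 (congrArg Subtype.val hP))
  obtain ⟨P, hP⟩ := LinearMap.injective_iff_surjective.mp hT ⟨G, hG⟩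
  exact ⟨P, P.2, congrArg Subtype.val hP⟩

theorem bijOn_mul_apolarComponent [Finite σ] {M : MvPolynomial σ K} {d : ℕ}
    (hF : F.IsHomogeneous (2 * k + d)) (hM : M.IsHomogeneous d)
    (hinj : ∀ P : MvPolynomial σ K, P.IsHomogeneous k → diffOp σ K (M * P) F = 0 → P = 0) :
    Set.BijOn (fun x => Ideal.Quotient.mk (annIdeal F) M * x)
      (apolarComponent F k) (apolarComponent F (k + d)) := by
  refine ⟨?_, ?_, ?_⟩
  · rintro _ ⟨P, hP, rfl⟩
    exact mk_mem_quotientComponent _ (add_comm d k ▸ hM.mul hP)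
  · rintro _ ⟨P, hP, rfl⟩ _ ⟨Q, hQ, rfl⟩ hPQ
    have hsub : diffOp σ K (M * (P - Q)) F = 0 := by
      rw [mul_sub, ← mem_annIdeal]
      exact Ideal.Quotient.eq.mp hPQ
    rw [sub_eq_zero.mp (hinj _ (hP.sub hQ) hsub)]
  · rintro _ ⟨Q, hQ, rfl⟩
    have hQF : (diffOp σ K Q F).IsHomogeneous k := by
      simpa [show 2 * k + d - (k + d) = k by omega] using isHomogeneous_diffOp hF hQ
    obtain ⟨P, hP, hPF⟩ := exists_diffOp_mul_eq_of_injective hF hM hinj hQF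
    refine ⟨_, mk_mem_quotientComponent _ hP, Ideal.Quotient.eq.mpr ?_⟩
    rw [mem_annIdeal, map_sub, LinearMap.sub_apply, hPF, sub_self]

theorem isStrongLefschetzElement_of_injective [Finite σ] (hF : F.IsHomogeneous s) (hF0 : F ≠ 0)
    (hL : L.IsHomogeneous 1)
    (hinj : ∀ k, 2 * k < s → ∀ P : MvPolynomial σ K, P.IsHomogeneous k →
      diffOp σ K (L ^ (s - 2 * k) * P) F = 0 → P = 0) :
    IsStrongLefschetzElement (apolarComponent F) (Ideal.Quotient.mk (annIdeal F) L) := by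
  have hLpow (d : ℕ) : (L ^ d).IsHomogeneous d := by simpa using hL.pow d
  have htop : apolarComponent F s ≠ ⊥ := by
    refine Submodule.ne_bot_iff _ |>.mpr ⟨_, mk_mem_quotientComponent _ (hLpow s), fun h => ?_⟩
    have hLF : diffOp σ K (L ^ s) F = 0 := Ideal.Quotient.eq_zero_iff_mem.mp h
    rcases s.eq_zero_or_pos with rfl | hs
    · exact hF0 (by simpa using hLF)
    · exact one_ne_zero (hinj 0 hs 1 (isHomogeneous_one σ K) (by simpa using hLF))
  refine ⟨s, isGradedArtinian_apolarComponent hF htop, mk_mem_quotientComponent _ hL,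
    fun k hk => ?_⟩
  rcases hk.eq_or_lt with rfl | hk
  · simpa [two_mul, Function.id_def] using Set.bijOn_id _
  · simpa [show k + (s - 2 * k) = s - k by omega] using bijOn_mul_apolarComponent
      (by rwa [Nat.add_sub_cancel' hk.le]) (hLpow (s - 2 * k)) (hinj k hk)

variable [Fintype σ]

theorem isHomogeneous_sum_smul_X (a : σ → K) :
    (∑ i, a i • X i : MvPolynomial σ K).IsHomogeneous 1 :=
  (homogeneousSubmodule σ K 1).sum_mem fun i _ =>
    (homogeneousSubmodule σ K 1).smul_mem _ (isHomogeneous_X K i)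

theorem diffOp_sum_smul_X (a : σ → K) (F : MvPolynomial σ K) :
    diffOp σ K (∑ i, a i • X i) F = ∑ i, a i • pderiv i F := by
  simp only [map_sum, map_smul, LinearMap.sum_apply, LinearMap.smul_apply, diffOp_X_apply]

theorem diffOp_sum_smul_X_pow (a : σ → K) (hG : G.IsHomogeneous k) :
    diffOp σ K ((∑ i, a i • X i) ^ k) G = C (k.factorial * eval a G) := by
  induction k generalizing G with
  | zero =>
    obtain ⟨c, rfl⟩ := exists_eq_C_of_isHomogeneous_zero hG
    simp
  | succ k ih =>
    have hLG : (diffOp σ K (∑ i, a i • X i) G).IsHomogeneous k :=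
      isHomogeneous_diffOp hG (isHomogeneous_sum_smul_X a)
    have heuler : eval a (diffOp σ K (∑ i, a i • X i) G) = (k + 1) * eval a G := by
      rw [diffOp_sum_smul_X]
      simpa [smul_eval] using congrArg (eval a) hG.sum_X_mul_pderiv
    rw [pow_succ, map_mul, Module.End.mul_apply, ih hLG, heuler, Nat.factorial_succ]
    push_cast
    ring_nf

/-- The Hessian matrix of a polynomial. -/
noncomputable def hessian {σ R : Type*} [CommSemiring R] (F : MvPolynomial σ R) :
    Matrix σ σ (MvPolynomial σ R) :=
  Matrix.of fun i j => pderiv i (pderiv j F)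

theorem hessian_mulVec_eq_zero_of_diffOp_eq_zero [CharZero K] {a v : σ → K}
    (hF : F.IsHomogeneous (k + 2))
    (h : diffOp σ K ((∑ i, a i • X i) ^ k * ∑ i, v i • X i) F = 0) :
    ((hessian F).map (eval a)).mulVec v = 0 := by
  ext i
  have hi : diffOp σ K ((∑ i, a i • X i) ^ k) (pderiv i (diffOp σ K (∑ i, v i • X i) F)) = 0 := by
    rw [← diffOp_X_apply, ← Module.End.mul_apply, ← Module.End.mul_apply, ← map_mul, ← map_mul,
      show (∑ i, a i • X i) ^ k * X i * ∑ i, v i • X i =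
        X i * ((∑ i, a i • X i) ^ k * ∑ i, v i • X i : MvPolynomial σ K) by ring,
      map_mul, Module.End.mul_apply, h, map_zero]
  have hdegree : (pderiv i (diffOp σ K (∑ i, v i • X i) F)).IsHomogeneous k :=
    (isHomogeneous_diffOp hF (isHomogeneous_sum_smul_X v)).pderiv
  rw [diffOp_sum_smul_X_pow a hdegree, C_eq_zero, mul_eq_zero,
    or_iff_right (Nat.cast_ne_zero.mpr k.factorial_ne_zero), diffOp_sum_smul_X] at hi
  simpa [hessian, Matrix.mulVec, dotProduct, smul_eval, mul_comm] using hi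

/-- In degree at most four only `×L^s : A_0 → A_s` and `×L^{s-2} : A_1 → A_{s-1}` are not
trivially bijective, and these are governed by the value and by the Hessian of `F` at `a`. -/
theorem isStrongLefschetzElement_of_det_hessian_ne_zero [CharZero K] [DecidableEq σ] {a : σ → K}
    (hF : F.IsHomogeneous s) (hs : s ≤ 4) (heval : eval a F ≠ 0)
    (hhessian : 3 ≤ s → ((hessian F).map (eval a)).det ≠ 0) :
    IsStrongLefschetzElement (apolarComponent F)
      (Ideal.Quotient.mk (annIdeal F) (∑ i, a i • X i)) := by
  refine isStrongLefschetzElement_of_injective hF (fun h => heval (by simp [h]))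
    (isHomogeneous_sum_smul_X a) fun k hk P hP hPF => ?_
  obtain rfl | rfl : k = 0 ∨ k = 1 := by omega
  · obtain ⟨c, rfl⟩ := exists_eq_C_of_isHomogeneous_zero hP
    rw [Nat.mul_zero, Nat.sub_zero, mul_comm, ← smul_eq_C_mul, map_smul, LinearMap.smul_apply,
      diffOp_sum_smul_X_pow a hF] at hPF
    simpa [heval, s.factorial_ne_zero] using hPF
  · obtain ⟨d, rfl⟩ := Nat.exists_eq_add_of_le' hk.le
    rw [← mem_homogeneousSubmodule, homogeneousSubmodule_one_eq_span_X,
      Submodule.mem_span_range_iff_exists_fun] at hP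
    obtain ⟨v, rfl⟩ := hP
    have hv : v = 0 := Matrix.eq_zero_of_mulVec_eq_zero (hhessian (by omega)) <|
      hessian_mulVec_eq_zero_of_diffOp_eq_zero hF hPF
    simp [hv]

end Lefschetz

section CauchyBinet

variable {ι E R : Type*} [Fintype ι] [DecidableEq ι] [Fintype E] [DecidableEq E] [CommRing R]

theorem mul_diagonal_mul_apply {l n : Type*} (A : Matrix l E R) (w : E → R) (B : Matrix E n R)
    (i : l) (j : n) : (A * Matrix.diagonal w * B) i j = ∑ e, A i e * w e * B e j := by
  rw [Matrix.mul_apply]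
  simp only [Matrix.mul_diagonal]

theorem det_mul_diagonal_mul (A : Matrix ι E R) (w : E → R) (B : Matrix E ι R) :
    (A * Matrix.diagonal w * B).det =
      ∑ f : ι → E, (∏ i, w (f i)) * ((∏ i, A i (f i)) * (B.submatrix f id).det) := by
  have hrow (i : ι) : (A * Matrix.diagonal w * B) i = ∑ e, (w e * A i e) • B e := by
    ext j
    simp [mul_diagonal_mul_apply, mul_comm (w _)]
  calc (A * Matrix.diagonal w * B).det
      = Matrix.detRowAlternating.toMultilinearMap fun i => ∑ e, (w e * A i e) • B e :=
        congrArg _ (funext hrow)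
    _ = _ := by
        rw [MultilinearMap.map_sum]
        refine Finset.sum_congr rfl fun f _ => ?_
        rw [MultilinearMap.map_smul_univ, Finset.prod_mul_distrib, smul_eq_mul, mul_assoc]
        rfl

/-- The Cauchy–Binet formula, with the product of the maximal minors of `A` and `B` on `T` expressed
as the determinant at the indicator function of `T`. -/
theorem det_mul_diagonal_mul_eq_sum_powersetCard (A : Matrix ι E R) (w : E → R)
    (B : Matrix E ι R) :
    (A * Matrix.diagonal w * B).det =
      ∑ T ∈ Finset.univ.powersetCard (Fintype.card ι), (∏ e ∈ T, w e) *
        (A * Matrix.diagonal (fun e => if e ∈ T then (1 : R) else 0) * B).det := by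
  simp only [det_mul_diagonal_mul, Finset.mul_sum]
  rw [Finset.sum_comm]
  refine Finset.sum_congr rfl fun f _ => ?_
  by_cases hf : Function.Injective f
  · have himage : Finset.univ.image f ∈ Finset.univ.powersetCard (Fintype.card ι) := by
      simp [Finset.mem_powersetCard, Finset.card_image_of_injective _ hf]
    rw [Finset.sum_eq_single_of_mem _ himage, Finset.prod_image hf.injOn]
    · simp
    · intro T hT hne
      obtain ⟨i, hi⟩ : ∃ i, f i ∉ T := by
        by_contra! hfT
        refine hne (Finset.eq_of_subset_of_card_le (Finset.image_subset_iff.mpr fun i _ => hfT i)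
          ?_).symm
        rw [(Finset.mem_powersetCard.mp hT).2, (Finset.mem_powersetCard.mp himage).2]
      rw [Finset.prod_eq_zero (Finset.mem_univ i) (if_neg hi), zero_mul, mul_zero]
  · obtain ⟨i, j, hij, hne⟩ := Function.not_injective_iff.mp hf
    have hdet : (B.submatrix f id).det = 0 :=
      Matrix.det_zero_of_row_eq hne (by ext; simp [hij])
    simp [hdet]

end CauchyBinet

section HessianOfDeterminant

theorem eval_add_single_monomial_of_le_one {σ R : Type*} [CommRing R] [DecidableEq σ]
    {m : σ →₀ ℕ} {i : σ} (hm : m i ≤ 1) (c : R) (a : σ → R) (t : R) :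
    eval (a + Pi.single i t) (monomial m c) =
      eval a (monomial m c) + t * eval a (pderiv i (monomial m c)) := by
  have hfree : eval (a + Pi.single i t) (monomial (m.erase i) c) =
      eval a (monomial (m.erase i) c) := by
    simp only [eval_monomial, Finsupp.prod]
    congr 1
    refine Finset.prod_congr rfl fun j hj => ?_
    have hji : j ≠ i := by
      rintro rfl
      simp at hj
    simp [hji]
  have hpderiv : pderiv i (monomial (m.erase i) c) = 0 := by simp [pderiv_monomial]
  have hsplit : monomial m c = X i ^ m i * monomial (m.erase i) c := by
    rw [X_pow_eq_monomial, monomial_mul, one_mul, Finsupp.single_add_erase]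
  rw [hsplit]
  obtain h | h : m i = 0 ∨ m i = 1 := by omega
  · rw [h, pow_zero, one_mul, hfree, hpderiv, map_zero, mul_zero, add_zero]
  · simp [h, hfree, hpderiv, add_mul]

theorem eval_add_single_of_degreeOf_le_one {σ R : Type*} [CommRing R] [DecidableEq σ]
    {F : MvPolynomial σ R} {i : σ} (hF : F.degreeOf i ≤ 1) (a : σ → R) (t : R) :
    eval (a + Pi.single i t) F = eval a F + t * eval a (pderiv i F) := by
  rw [F.as_sum]
  simp only [map_sum, Finset.mul_sum, ← Finset.sum_add_distrib]
  exact Finset.sum_congr rfl fun m hm =>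
    eval_add_single_monomial_of_le_one ((degreeOf_le_iff.mp hF) m hm) _ a t

theorem degreeOf_pderiv_le {σ R : Type*} [CommSemiring R] (F : MvPolynomial σ R) (i j : σ) :
    (pderiv i F).degreeOf j ≤ F.degreeOf j := by
  rw [degreeOf_le_iff]
  intro m hm
  rw [mem_support_iff, coeff_pderiv] at hm
  calc m j ≤ (m + Finsupp.single i 1 : σ →₀ ℕ) j := by simp
    _ ≤ F.degreeOf j :=
      degreeOf_le_iff.mp le_rfl _ (mem_support_iff.mpr (left_ne_zero_of_mul hm))

theorem eval_pderiv_pderiv_of_degreeOf_le_one {σ R : Type*} [CommRing R] [DecidableEq σ]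
    {F : MvPolynomial σ R} (hF : ∀ i, F.degreeOf i ≤ 1) (a : σ → R) (i j : σ) :
    eval a (pderiv i (pderiv j F)) = eval (a + Pi.single i 1 + Pi.single j 1) F -
      eval (a + Pi.single i 1) F - eval (a + Pi.single j 1) F + eval a F := by
  simp only [eval_add_single_of_degreeOf_le_one (hF _),
    eval_add_single_of_degreeOf_le_one ((degreeOf_pderiv_le F _ _).trans (hF i))]
  ring

variable {ι E R : Type*} [Fintype ι] [DecidableEq ι] [Fintype E] [DecidableEq E] [CommRing R]

theorem det_mul_diagonal_add_sum_single_mul {κ : Type*} [Fintype κ] [DecidableEq κ]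
    {A : Matrix ι E R} {w : E → R} {B : Matrix E ι R}
    (hdet : IsUnit (A * Matrix.diagonal w * B).det) (f : κ → E) :
    (A * Matrix.diagonal (w + ∑ k, Pi.single (f k) 1) * B).det =
      (A * Matrix.diagonal w * B).det *
        (1 + (B * (A * Matrix.diagonal w * B)⁻¹ * A).submatrix f f).det := by
  have hupdate : A * Matrix.diagonal (w + ∑ k, Pi.single (f k) 1) * B =
      A * Matrix.diagonal w * B + A.submatrix id f * B.submatrix f id := by
    ext i j
    simp only [mul_diagonal_mul_apply, Matrix.add_apply, Matrix.mul_apply (M := A.submatrix id f),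
      Matrix.submatrix_apply, id, Pi.add_apply, Finset.sum_apply, Pi.single_apply, mul_add, add_mul,
      Finset.sum_add_distrib, Finset.mul_sum, Finset.sum_mul, mul_ite, ite_mul, mul_one, mul_zero,
      zero_mul]
    rw [Finset.sum_comm (s := Finset.univ (α := E))]
    simp
  rw [hupdate, Matrix.det_add_mul _ _ hdet]
  rfl

/-- The matrix of the principal `2 × 2` minors of `P`, that is, of the minors of `P` on the rows
`i, j` and the columns `i, j`. -/
def principalMinorMatrix (P : Matrix E E R) : Matrix E E R :=
  Matrix.of fun i j => P i i * P j j - P i j * P j i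

theorem hessian_map_eval_of_eval_eq_det {F : MvPolynomial E R} (hdegree : ∀ i, F.degreeOf i ≤ 1)
    {A : Matrix ι E R} {B : Matrix E ι R}
    (hF : ∀ w, eval w F = (A * Matrix.diagonal w * B).det) {a : E → R}
    (hdet : IsUnit (A * Matrix.diagonal a * B).det) :
    (hessian F).map (eval a) = eval a F •
      principalMinorMatrix (B * (A * Matrix.diagonal a * B)⁻¹ * A) := by
  ext i j
  set P := B * (A * Matrix.diagonal a * B)⁻¹ * A
  have hone (k : E) : eval (a + Pi.single k 1) F = eval a F * (1 + P k k) := by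
    simpa only [hF, Matrix.det_fin_one, Matrix.add_apply, Matrix.one_apply_eq,
      Matrix.submatrix_apply, Matrix.cons_val_zero, Fin.sum_univ_one]
      using det_mul_diagonal_add_sum_single_mul hdet ![k]
  have htwo : eval (a + Pi.single i 1 + Pi.single j 1) F =
      eval a F * ((1 + P i i) * (1 + P j j) - P i j * P j i) := by
    simpa [hF, Matrix.det_fin_two, add_assoc, -Matrix.submatrix_cons_row] using
      det_mul_diagonal_add_sum_single_mul hdet ![i, j]
  simp only [hessian, Matrix.map_apply, Matrix.of_apply, Matrix.smul_apply, principalMinorMatrix,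
    eval_pderiv_pderiv_of_degreeOf_le_one hdegree, hone, htwo, smul_eq_mul]
  ring

end HessianOfDeterminant

section Projection

variable {ι E R : Type*} [Fintype ι] [Fintype E]

section CommRing

variable [CommRing R] [DecidableEq ι] {B : Matrix E ι R}

/-- The orthogonal projection onto the column space of `B`, for a matrix `B` whose Gram matrix
`Bᵀ * B` is invertible. -/
noncomputable def columnProjection (B : Matrix E ι R) : Matrix E E R :=
  B * (Bᵀ * B)⁻¹ * Bᵀ

theorem isSymm_columnProjection (B : Matrix E ι R) : (columnProjection B).IsSymm := by
  simp [Matrix.IsSymm, columnProjection, Matrix.transpose_nonsing_inv, Matrix.mul_assoc]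

theorem transpose_mul_columnProjection (hB : IsUnit (Bᵀ * B).det) :
    Bᵀ * columnProjection B = Bᵀ := by
  rw [columnProjection, ← Matrix.mul_assoc, ← Matrix.mul_assoc, Matrix.mul_nonsing_inv _ hB,
    Matrix.one_mul]

theorem columnProjection_mul (hB : IsUnit (Bᵀ * B).det) : columnProjection B * B = B := by
  rw [columnProjection, Matrix.mul_assoc, Matrix.mul_assoc, Matrix.nonsing_inv_mul _ hB,
    Matrix.mul_one]

theorem isIdempotentElem_columnProjection (hB : IsUnit (Bᵀ * B).det) :
    IsIdempotentElem (columnProjection B) := by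
  rw [IsIdempotentElem]
  nth_rw 2 [columnProjection]
  rw [← Matrix.mul_assoc, ← Matrix.mul_assoc, columnProjection_mul hB, ← columnProjection]

theorem trace_columnProjection (hB : IsUnit (Bᵀ * B).det) :
    (columnProjection B).trace = Fintype.card ι := by
  rw [columnProjection, Matrix.trace_mul_comm, ← Matrix.mul_assoc, Matrix.mul_nonsing_inv _ hB,
    Matrix.trace_one]

theorem transpose_mul_diagonal_mul_eq_zero [DecidableEq E] (hB : IsUnit (Bᵀ * B).det)
    {v : E → R} (hv : columnProjection B * Matrix.diagonal v * columnProjection B = 0) :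
    Bᵀ * Matrix.diagonal v * B = 0 :=
  calc Bᵀ * Matrix.diagonal v * B
      = Bᵀ * columnProjection B * Matrix.diagonal v * (columnProjection B * B) := by
        rw [transpose_mul_columnProjection hB, columnProjection_mul hB]
    _ = Bᵀ * (columnProjection B * Matrix.diagonal v * columnProjection B) * B := by
        simp only [Matrix.mul_assoc]
    _ = 0 := by rw [hv, Matrix.mul_zero, Matrix.zero_mul]

end CommRing

variable [Field R] [LinearOrder R] [IsStrictOrderedRing R]

theorem eq_zero_of_trace_mul_transpose_eq_zero {M : Matrix E ι R}
    (hM : (M * Mᵀ).trace = 0) : M = 0 := by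
  have hnonneg (i : E) : 0 ≤ M i ⬝ᵥ M i := Finset.sum_nonneg fun j _ => mul_self_nonneg (M i j)
  funext i
  exact dotProduct_self_eq_zero.mp <|
    (Finset.sum_eq_zero_iff_of_nonneg fun i _ => hnonneg i).mp hM i (Finset.mem_univ i)

variable [DecidableEq E] {P : Matrix E E R}

theorem mul_diagonal_mul_eq_zero_of_sum_sq_mul_eq_zero (hsymm : P.IsSymm)
    (hidem : IsIdempotentElem P) {u : E → R} (hu : ∀ i, ∑ j, P i j ^ 2 * u j = 0) :
    P * Matrix.diagonal u * P = 0 := by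
  refine eq_zero_of_trace_mul_transpose_eq_zero ?_
  calc (P * Matrix.diagonal u * P * (P * Matrix.diagonal u * P)ᵀ).trace
      = (P * (Matrix.diagonal u * (P * P) * Matrix.diagonal u * P)).trace := by
        simp only [Matrix.transpose_mul, Matrix.diagonal_transpose, hsymm.eq, Matrix.mul_assoc]
    _ = (Matrix.diagonal u * (P * Matrix.diagonal u * P)).trace := by
        rw [Matrix.trace_mul_comm, hidem, Matrix.mul_assoc _ P P, hidem]
        simp only [Matrix.mul_assoc]
    _ = ∑ i, u i * ∑ j, P i j ^ 2 * u j := by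
        refine Finset.sum_congr rfl fun i _ => ?_
        rw [Matrix.diag_apply, Matrix.diagonal_mul, mul_diagonal_mul_apply]
        refine congrArg _ (Finset.sum_congr rfl fun j _ => ?_)
        rw [hsymm.apply i j]
        ring
    _ = 0 := Finset.sum_eq_zero fun i _ => by rw [hu i, mul_zero]

/-- A kernel vector `v` of the minor matrix satisfies `∑ j, P i j ^ 2 * v j = c * P i i` with
`c = ∑ j, P j j * v j`; as `P` is idempotent, so does the constant vector `c`, and the difference
`u = v - c` gives `P * diagonal u * P = 0`. -/
theorem det_principalMinorMatrix_ne_zero (hsymm : P.IsSymm) (hidem : IsIdempotentElem P)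
    (htrace : P.trace ≠ 1)
    (hdiagonal : ∀ v : E → R, P * Matrix.diagonal v * P = 0 → v = 0) :
    (principalMinorMatrix P).det ≠ 0 := by
  rw [Ne, ← Matrix.exists_mulVec_eq_zero_iff]
  rintro ⟨v, hv0, hv⟩
  set c := ∑ j, P j j * v j
  have hkernel (i : E) : ∑ j, P i j ^ 2 * v j = c * P i i := by
    have hi : ∑ j, (P i i * P j j - P i j * P j i) * v j = 0 := congrFun hv i
    rw [← sub_eq_zero, ← neg_eq_zero, ← hi, Finset.sum_mul, ← Finset.sum_sub_distrib,
      ← Finset.sum_neg_distrib]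
    refine Finset.sum_congr rfl fun j _ => ?_
    rw [hsymm.apply i j]
    ring
  have hidem_diag (i : E) : ∑ j, P i j ^ 2 = P i i := by
    conv_rhs => rw [← hidem.eq, Matrix.mul_apply]
    exact Finset.sum_congr rfl fun j _ => by rw [hsymm.apply i j, sq]
  have hv_const : v - (fun _ => c) = 0 := by
    refine hdiagonal _ (mul_diagonal_mul_eq_zero_of_sum_sq_mul_eq_zero hsymm hidem fun i => ?_)
    simp only [Pi.sub_apply, mul_sub, Finset.sum_sub_distrib, ← Finset.sum_mul, hkernel, hidem_diag]
    ring
  have hc : c = P.trace * c := by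
    rw [Matrix.trace, Finset.sum_mul]
    exact Finset.sum_congr rfl fun j _ => by rw [congrFun (sub_eq_zero.mp hv_const) j]; rfl
  have hc0 : c = 0 := by
    have : (P.trace - 1) * c = 0 := by linarith
    exact (mul_eq_zero.mp this).resolve_left (sub_ne_zero.mpr htrace)
  exact hv0 (by rw [sub_eq_zero.mp hv_const, hc0]; rfl)

end Projection

section SpanningSubgraph

variable {V : Type*} {Γ : SimpleGraph V}

/-- The spanning subgraph of `Γ` with the set of edges `T`. -/
abbrev spanningSubgraph (T : Finset Γ.edgeSet) : SimpleGraph V :=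
  SimpleGraph.fromEdgeSet (Subtype.val '' (T : Set Γ.edgeSet))

theorem edgeSet_spanningSubgraph (T : Finset Γ.edgeSet) :
    (spanningSubgraph T).edgeSet = Subtype.val '' (T : Set Γ.edgeSet) := by
  rw [SimpleGraph.edgeSet_fromEdgeSet, sdiff_eq_left, Set.disjoint_left]
  rintro _ ⟨e, -, rfl⟩ hdiag
  exact Γ.not_isDiag_of_mem_edgeSet e.2 hdiag

theorem isTree_spanningSubgraph_iff [Finite V] {T : Finset Γ.edgeSet} :
    (spanningSubgraph T).IsTree ↔ (spanningSubgraph T).Connected ∧ T.card + 1 = Nat.card V := by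
  rw [SimpleGraph.isTree_iff_connected_and_card, edgeSet_spanningSubgraph,
    Nat.card_image_of_injective Subtype.val_injective, Nat.card_coe_set_eq, Set.ncard_coe_finset]

theorem exists_isTree_spanningSubgraph [Finite Γ.edgeSet] (hΓ : Γ.Connected) :
    ∃ T : Finset Γ.edgeSet, (spanningSubgraph T).IsTree := by
  obtain ⟨T, hTΓ, hT⟩ := hΓ.exists_isTree_le
  have hfinite : {e : Γ.edgeSet | e.1 ∈ T.edgeSet}.Finite := Set.toFinite _
  refine ⟨hfinite.toFinset, ?_⟩
  have himage : Subtype.val '' {e : Γ.edgeSet | e.1 ∈ T.edgeSet} = T.edgeSet := by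
    rw [← Set.preimage_ofPred_eq, Set.ofPred_mem_eq, Subtype.image_preimage_coe,
      Set.inter_eq_right.mpr (SimpleGraph.edgeSet_mono hTΓ)]
  rwa [spanningSubgraph, hfinite.coe_toFinset, himage, SimpleGraph.fromEdgeSet_edgeSet]

theorem sym2_mk_out (e : Γ.edgeSet) : s((Quot.out e.1).1, (Quot.out e.1).2) = e.1 := Quot.out_eq e.1

theorem out_fst_ne_out_snd (e : Γ.edgeSet) : (Quot.out e.1).1 ≠ (Quot.out e.1).2 := fun h =>
  Γ.not_isDiag_of_mem_edgeSet e.2 (by rw [← sym2_mk_out e]; exact h)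

theorem adj_spanningSubgraph_of_mem {T : Finset Γ.edgeSet} {e : Γ.edgeSet} (he : e ∈ T) :
    (spanningSubgraph T).Adj (Quot.out e.1).1 (Quot.out e.1).2 :=
  (SimpleGraph.fromEdgeSet_adj _).mpr ⟨⟨e, he, (sym2_mk_out e).symm⟩, out_fst_ne_out_snd e⟩

theorem apply_eq_of_reachable_spanningSubgraph {T : Finset Γ.edgeSet} {R : Type*} {x : V → R}
    (hx : ∀ e ∈ T, x (Quot.out e.1).1 = x (Quot.out e.1).2) {u v : V}
    (huv : (spanningSubgraph T).Reachable u v) : x u = x v := by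
  rw [SimpleGraph.reachable_iff_reflTransGen] at huv
  induction huv with
  | refl => rfl
  | tail _ hadj ih =>
    obtain ⟨⟨e, he, heq⟩, -⟩ := (SimpleGraph.fromEdgeSet_adj _).mp hadj
    rw [← sym2_mk_out e, Sym2.eq_iff] at heq
    have := hx e he
    rcases heq with ⟨h1, h2⟩ | ⟨h1, h2⟩ <;> simp_all

end SpanningSubgraph

section IncidenceMatrix

variable {V R : Type*} [CommRing R] {Γ : SimpleGraph V} {r : V}

theorem exists_eq_sub_apply_root (y : {v // v ≠ r} → R) :
    ∃ x : V → R, (fun v : {v // v ≠ r} => x v - x r) = y := by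
  classical
  exact ⟨fun v => if h : v ≠ r then y ⟨v, h⟩ else 0, by ext v; simp [v.2]⟩

variable [DecidableEq V]

variable (R Γ r) in
/-- The incidence matrix of `Γ`, each edge `e` being oriented by the arbitrary choice `Quot.out e`
of its ends, with the column of the root `r` deleted. -/
noncomputable def reducedIncidence : Matrix Γ.edgeSet {v // v ≠ r} R :=
  Matrix.of fun e v => (Pi.single (Quot.out e.1).1 1 - Pi.single (Quot.out e.1).2 1 : V → R) v

theorem reducedIncidence_mulVec_sub [Fintype V] (x : V → R) (e : Γ.edgeSet) :
    (reducedIncidence R Γ r).mulVec (fun v => x v - x r) e =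
      x (Quot.out e.1).1 - x (Quot.out e.1).2 := by
  set c : V → R := Pi.single (Quot.out e.1).1 1 - Pi.single (Quot.out e.1).2 1 with hc
  calc ∑ v : {v // v ≠ r}, c v * (x v - x r)
      = ∑ v ∈ Finset.univ.erase r, c v * (x v - x r) :=
        (Finset.sum_subtype _ (by simp) fun v => c v * (x v - x r)).symm
    _ = ∑ v, c v * (x v - x r) := Finset.sum_erase _ (by simp)
    _ = x (Quot.out e.1).1 - x (Quot.out e.1).2 := by simp [hc, Pi.single_apply, sub_mul]

theorem eq_zero_of_transpose_mul_diagonal_mul_reducedIncidence [Finite V] [Fintype Γ.edgeSet]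
    [DecidableEq Γ.edgeSet] {w : Γ.edgeSet → R}
    (hw : (reducedIncidence R Γ r)ᵀ * Matrix.diagonal w * reducedIncidence R Γ r = 0) :
    w = 0 := by
  have := Fintype.ofFinite V
  set B := reducedIncidence R Γ r
  have hform (x y : V → R) : ∑ e : Γ.edgeSet, (x (Quot.out e.1).1 - x (Quot.out e.1).2) *
      (w e * (y (Quot.out e.1).1 - y (Quot.out e.1).2)) = 0 := by
    calc _ = B.mulVec (fun v => x v - x r) ⬝ᵥ
        (Matrix.diagonal w).mulVec (B.mulVec fun v => y v - y r) := by
          simp only [dotProduct, Matrix.mulVec_diagonal, B, reducedIncidence_mulVec_sub]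
      _ = (fun v : {v // v ≠ r} => x v - x r) ⬝ᵥ
        (Bᵀ * Matrix.diagonal w * B).mulVec fun v => y v - y r := by
          rw [Matrix.mul_assoc, ← Matrix.mulVec_mulVec, Matrix.dotProduct_mulVec _ Bᵀ,
            Matrix.vecMul_transpose, Matrix.mulVec_mulVec]
      _ = 0 := by rw [hw, Matrix.zero_mulVec, dotProduct_zero]
  ext e
  have he := hform (Pi.single (Quot.out e.1).1 1) (Pi.single (Quot.out e.1).2 1)
  rw [Finset.sum_eq_single e] at he
  · simpa [out_fst_ne_out_snd e, (out_fst_ne_out_snd e).symm] using he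
  · intro e' _ hne
    have hends :
        s((Quot.out e'.1).1, (Quot.out e'.1).2) ≠ s((Quot.out e.1).1, (Quot.out e.1).2) := by
      rwa [sym2_mk_out, sym2_mk_out, Ne, Subtype.val_inj]
    have h := out_fst_ne_out_snd e
    have h' := out_fst_ne_out_snd e'
    simp only [Ne, Sym2.eq_iff, not_or, not_and] at hends
    simp only [Pi.single_apply]
    split_ifs <;> simp_all
  · simp

end IncidenceMatrix

section MatrixTree

variable {V R : Type*} [Fintype V] [DecidableEq V] [CommRing R] {Γ : SimpleGraph V} {r : V}

theorem det_submatrix_reducedIncidence_eq_zero_iff [IsDomain R] {T : Finset Γ.edgeSet}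
    (φ : {v // v ≠ r} ≃ T) :
    ((reducedIncidence R Γ r).submatrix (fun v => (φ v).1) id).det = 0 ↔
      ¬ (spanningSubgraph T).Connected := by
  have hmulVec (x : V → R) : ((reducedIncidence R Γ r).submatrix (fun v => (φ v).1) id).mulVec
      (fun v => x v - x r) = 0 ↔ ∀ e ∈ T, x (Quot.out e.1).1 = x (Quot.out e.1).2 := by
    calc _ ↔ ∀ v, (reducedIncidence R Γ r).mulVec (fun v => x v - x r) (φ v).1 = 0 := funext_iff
      _ ↔ ∀ e : T, x (Quot.out e.1.1).1 = x (Quot.out e.1.1).2 := by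
          simp only [reducedIncidence_mulVec_sub, sub_eq_zero]
          exact φ.forall_congr_right (q := fun e => x (Quot.out e.1.1).1 = x (Quot.out e.1.1).2)
      _ ↔ _ := Subtype.forall
  rw [← Matrix.exists_mulVec_eq_zero_iff]
  constructor
  · rintro ⟨y, hy, hker⟩ hconn
    obtain ⟨x, rfl⟩ := exists_eq_sub_apply_root y
    refine hy (funext fun v => sub_eq_zero.mpr ?_)
    exact apply_eq_of_reachable_spanningSubgraph ((hmulVec x).mp hker) (hconn.preconnected _ _)
  · intro hconn
    classical
    have hroot : ∃ u, ¬ (spanningSubgraph T).Reachable r u := by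
      by_contra! h
      exact hconn ((SimpleGraph.connected_iff_exists_forall_reachable _).mpr ⟨r, h⟩)
    obtain ⟨u, hu⟩ := hroot
    let x : V → R := fun v => if (spanningSubgraph T).Reachable r v then 0 else 1
    have hxr : x r = 0 := if_pos (SimpleGraph.Reachable.refl r)
    have hxu : x u = 1 := if_neg hu
    have hur : u ≠ r := by rintro rfl; exact hu (SimpleGraph.Reachable.refl u)
    refine ⟨fun v => x v - x r, fun h => ?_, (hmulVec x).mpr fun e he => ?_⟩
    · simpa [hxu, hxr] using congrFun h ⟨u, hur⟩
    · have hadj := (adj_spanningSubgraph_of_mem he).reachable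
      have hiff : (spanningSubgraph T).Reachable r (Quot.out e.1).1 ↔
          (spanningSubgraph T).Reachable r (Quot.out e.1).2 :=
        ⟨fun h => h.trans hadj, fun h => h.trans hadj.symm⟩
      simp only [x, hiff]

omit [Fintype V] in
theorem map_reducedIncidence {S : Type*} [CommRing S] (f : R →+* S) :
    (reducedIncidence R Γ r).map f = reducedIncidence S Γ r := by
  ext e v
  simp [reducedIncidence, Pi.single_apply, apply_ite f]

theorem map_det_submatrix_reducedIncidence {S : Type*} [CommRing S] (f : R →+* S)
    (g : {v // v ≠ r} → Γ.edgeSet) :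
    f ((reducedIncidence R Γ r).submatrix g id).det =
      ((reducedIncidence S Γ r).submatrix g id).det := by
  rw [RingHom.map_det, RingHom.mapMatrix_apply, ← Matrix.submatrix_map, map_reducedIncidence]

theorem isUnit_det_submatrix_reducedIncidence {T : Finset Γ.edgeSet} (φ : {v // v ≠ r} ≃ T)
    (hT : (spanningSubgraph T).Connected) :
    IsUnit ((reducedIncidence ℤ Γ r).submatrix (fun v => (φ v).1) id).det := by
  rw [Int.isUnit_iff_natAbs_eq, Nat.eq_one_iff_not_exists_prime_dvd]
  intro p hp hdvd
  have := Fact.mk hp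
  rw [← Int.natCast_dvd, ← ZMod.intCast_zmod_eq_zero_iff_dvd, ← eq_intCast (Int.castRingHom _),
    map_det_submatrix_reducedIncidence, det_submatrix_reducedIncidence_eq_zero_iff] at hdvd
  exact hdvd hT

open Classical in
theorem det_submatrix_reducedIncidence_sq {T : Finset Γ.edgeSet} (φ : {v // v ≠ r} ≃ T) :
    ((reducedIncidence R Γ r).submatrix (fun v => (φ v).1) id).det ^ 2 =
      if (spanningSubgraph T).Connected then 1 else 0 := by
  rw [← map_det_submatrix_reducedIncidence (Int.castRingHom R), ← map_pow]
  split_ifs with hT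
  · rw [Int.isUnit_sq (isUnit_det_submatrix_reducedIncidence φ hT), map_one]
  · rw [(det_submatrix_reducedIncidence_eq_zero_iff φ).mpr hT, zero_pow two_ne_zero, map_zero]

open Classical in
theorem det_transpose_mul_diagonal_ite_mul_reducedIncidence [Fintype Γ.edgeSet]
    [DecidableEq Γ.edgeSet] {T : Finset Γ.edgeSet} (hT : T.card = Fintype.card {v // v ≠ r}) :
    ((reducedIncidence R Γ r)ᵀ * Matrix.diagonal (fun e => if e ∈ T then (1 : R) else 0) *
      reducedIncidence R Γ r).det = if (spanningSubgraph T).Connected then 1 else 0 := by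
  let φ : {v // v ≠ r} ≃ T := Fintype.equivOfCardEq (by rw [Fintype.card_coe, hT])
  have hsplit : (reducedIncidence R Γ r)ᵀ *
      Matrix.diagonal (fun e => if e ∈ T then (1 : R) else 0) * reducedIncidence R Γ r =
      ((reducedIncidence R Γ r).submatrix (fun v => (φ v).1) id)ᵀ *
        (reducedIncidence R Γ r).submatrix (fun v => (φ v).1) id := by
    ext u v
    rw [mul_diagonal_mul_apply, Matrix.mul_apply]
    simp only [mul_ite, mul_one, mul_zero, ite_mul, zero_mul, Finset.sum_ite_mem,
      Finset.univ_inter]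
    rw [← Finset.sum_coe_sort]
    exact (φ.sum_comp fun e => (reducedIncidence R Γ r)ᵀ u e.1 *
      reducedIncidence R Γ r e.1 v).symm
  rw [hsplit, Matrix.det_mul, Matrix.det_transpose, ← sq, det_submatrix_reducedIncidence_sq]

end MatrixTree

section KirchhoffPolynomial

variable {V : Type*} {K : Type*} [Field K] {Γ : SimpleGraph V} [Fintype Γ.edgeSet]

open Classical in
-- In the definition, the binder `T` of the sum elaborates to the `Finset (Set Γ.edgeSet)` of the
-- coercions of all finsets of edges.
theorem kirchhoffPolynomial_eq_sum : kirchhoffPolynomial K Γ =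
    ∑ T : Finset Γ.edgeSet with (spanningSubgraph T).IsTree, ∏ e ∈ T, X e := by
  unfold kirchhoffPolynomial
  symm
  refine Finset.sum_nbij (fun T : Finset Γ.edgeSet => (T : Set Γ.edgeSet)) ?_ ?_ ?_ ?_
  · intro T hT
    simpa [Finset.bind_def, Finset.mem_sup, Finset.pure_def] using (Finset.mem_filter.mp hT).2
  · exact Finset.coe_injective.injOn
  · intro S hS
    simp only [Finset.bind_def, Finset.pure_def, Finset.coe_filter, Finset.mem_sup,
      Finset.mem_univ, Finset.mem_singleton, true_and, Set.mem_ofPred_eq] at hS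
    obtain ⟨⟨T, rfl⟩, hT⟩ := hS
    exact ⟨T, by simpa using hT, rfl⟩
  · intro T _
    simp

theorem isHomogeneous_kirchhoffPolynomial [Finite V] :
    (kirchhoffPolynomial K Γ).IsHomogeneous (Nat.card V - 1) := by
  classical
  rw [kirchhoffPolynomial_eq_sum]
  refine IsHomogeneous.sum _ _ _ fun T hT => ?_
  obtain ⟨-, hcard⟩ := isTree_spanningSubgraph_iff.mp (Finset.mem_filter.mp hT).2
  rw [← hcard, Nat.add_sub_cancel, Finset.card_eq_sum_ones]
  exact IsHomogeneous.prod _ _ _ fun e _ => isHomogeneous_X K e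

theorem degreeOf_kirchhoffPolynomial_le_one (e : Γ.edgeSet) :
    (kirchhoffPolynomial K Γ).degreeOf e ≤ 1 := by
  classical
  rw [kirchhoffPolynomial_eq_sum]
  refine (degreeOf_sum_le _ _ _).trans (Finset.sup_le fun T _ => ?_)
  refine (degreeOf_prod_le _ _ _).trans ?_
  simp only [degreeOf_X, Finset.sum_ite_eq]
  split_ifs <;> simp

theorem map_kirchhoffPolynomial {L : Type*} [Field L] (f : K →+* L) :
    map f (kirchhoffPolynomial K Γ) = kirchhoffPolynomial L Γ := by
  simp [kirchhoffPolynomial_eq_sum]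

theorem eval_one_kirchhoffPolynomial_ne_zero [CharZero K] (hΓ : Γ.Connected) :
    eval 1 (kirchhoffPolynomial K Γ) ≠ 0 := by
  classical
  obtain ⟨T, hT⟩ := exists_isTree_spanningSubgraph hΓ
  have hne : ({T : Finset Γ.edgeSet | (spanningSubgraph T).IsTree} : Finset _).Nonempty :=
    ⟨T, Finset.mem_filter.mpr ⟨Finset.mem_univ T, hT⟩⟩
  rw [kirchhoffPolynomial_eq_sum]
  simpa using hne.ne_empty

theorem card_ne_root_add_one [Fintype V] [DecidableEq V] (r : V) :
    Fintype.card {v // v ≠ r} + 1 = Nat.card V := by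
  rw [Nat.card_eq_fintype_card, Fintype.card_subtype_compl, Fintype.card_subtype_eq,
    Nat.sub_add_cancel (Fintype.card_pos_iff.mpr ⟨r⟩)]

theorem eval_kirchhoffPolynomial [Fintype V] [DecidableEq V] [DecidableEq Γ.edgeSet] (r : V)
    (w : Γ.edgeSet → K) : eval w (kirchhoffPolynomial K Γ) =
      ((reducedIncidence K Γ r)ᵀ * Matrix.diagonal w * reducedIncidence K Γ r).det := by
  classical
  have hfilter : (Finset.univ.filter fun T : Finset Γ.edgeSet => (spanningSubgraph T).IsTree) =
      (Finset.univ.powersetCard (Fintype.card {v // v ≠ r})).filter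
        fun T : Finset Γ.edgeSet => (spanningSubgraph T).Connected := by
    ext T
    rw [Finset.mem_filter, Finset.mem_filter, isTree_spanningSubgraph_iff, ← card_ne_root_add_one r,
      Finset.mem_powersetCard_univ, Nat.add_right_cancel_iff, and_comm (b := _ = _),
      and_iff_right (Finset.mem_univ T)]
  rw [det_mul_diagonal_mul_eq_sum_powersetCard, kirchhoffPolynomial_eq_sum, hfilter,
    Finset.sum_filter, map_sum]
  refine Finset.sum_congr rfl fun T hT => ?_
  rw [det_transpose_mul_diagonal_ite_mul_reducedIncidence (Finset.mem_powersetCard_univ.mp hT),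
    apply_ite (eval w), map_zero, map_prod, mul_ite, mul_one, mul_zero]
  simp only [eval_X]

theorem isUnit_det_transpose_mul_reducedIncidence [CharZero K] [Fintype V] [DecidableEq V] (r : V)
    (hΓ : Γ.Connected) :
    IsUnit ((reducedIncidence K Γ r)ᵀ * reducedIncidence K Γ r).det := by
  classical
  have heval := eval_one_kirchhoffPolynomial_ne_zero (K := K) hΓ
  rwa [eval_kirchhoffPolynomial r, Matrix.diagonal_one', Matrix.mul_one, ← isUnit_iff_ne_zero]
    at heval

theorem hessian_kirchhoffPolynomial_map_eval_one [CharZero K] [Fintype V] [DecidableEq V] (r : V)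
    (hΓ : Γ.Connected) : (hessian (kirchhoffPolynomial K Γ)).map (eval 1) =
      eval 1 (kirchhoffPolynomial K Γ) •
        principalMinorMatrix (columnProjection (reducedIncidence K Γ r)) := by
  classical
  have hone : (reducedIncidence K Γ r)ᵀ * Matrix.diagonal (1 : Γ.edgeSet → K) =
      (reducedIncidence K Γ r)ᵀ := by rw [Matrix.diagonal_one', Matrix.mul_one]
  have hhessian := hessian_map_eval_of_eval_eq_det degreeOf_kirchhoffPolynomial_le_one
    (eval_kirchhoffPolynomial (K := K) (Γ := Γ) r) (a := 1)
    (by rw [hone]; exact isUnit_det_transpose_mul_reducedIncidence r hΓ)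
  rwa [hone] at hhessian

theorem det_hessian_kirchhoffPolynomial_ne_zero_of_linearOrder [LinearOrder K]
    [IsStrictOrderedRing K] [Finite V] [DecidableEq Γ.edgeSet] (hΓ : Γ.Connected)
    (hV : Nat.card V ≠ 2) : ((hessian (kirchhoffPolynomial K Γ)).map (eval 1)).det ≠ 0 := by
  have := Fintype.ofFinite V
  have := Classical.decEq V
  obtain ⟨r⟩ := hΓ.nonempty
  have hB := isUnit_det_transpose_mul_reducedIncidence (K := K) r hΓ
  rw [hessian_kirchhoffPolynomial_map_eval_one r hΓ, Matrix.det_smul]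
  refine mul_ne_zero (pow_ne_zero _ (eval_one_kirchhoffPolynomial_ne_zero hΓ))
    (det_principalMinorMatrix_ne_zero (isSymm_columnProjection _)
      (isIdempotentElem_columnProjection hB) ?_ fun v hv => ?_)
  · rw [trace_columnProjection hB, Ne, Nat.cast_eq_one]
    have := card_ne_root_add_one r
    omega
  · exact eq_zero_of_transpose_mul_diagonal_mul_reducedIncidence
      (transpose_mul_diagonal_mul_eq_zero hB hv)

theorem det_hessian_kirchhoffPolynomial_ne_zero [CharZero K] [Finite V] [DecidableEq Γ.edgeSet]
    (hΓ : Γ.Connected) (hV : Nat.card V ≠ 2) :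
    ((hessian (kirchhoffPolynomial K Γ)).map (eval 1)).det ≠ 0 := by
  have hmap : (hessian (kirchhoffPolynomial K Γ)).map (eval 1) =
      (algebraMap ℚ K).mapMatrix ((hessian (kirchhoffPolynomial ℚ Γ)).map (eval 1)) := by
    ext i j
    simp only [hessian, Matrix.map_apply, Matrix.of_apply, RingHom.mapMatrix_apply,
      ← map_kirchhoffPolynomial (algebraMap ℚ K), pderiv_map, eval_map]
    rw [eval₂_comp, Pi.comp_one, map_one, Function.const_one]
  rw [hmap, ← RingHom.map_det, Ne, map_eq_zero]
  exact det_hessian_kirchhoffPolynomial_ne_zero_of_linearOrder hΓ hV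

end KirchhoffPolynomial

theorem connected_completeBipartiteGraph {α β : Type*} [Nonempty α] [Nonempty β] :
    (completeBipartiteGraph α β).Connected := by
  obtain ⟨a₀⟩ := ‹Nonempty α›
  obtain ⟨b₀⟩ := ‹Nonempty β›
  have hadj (a : α) (b : β) : (completeBipartiteGraph α β).Adj (Sum.inl a) (Sum.inr b) := by simp
  refine (SimpleGraph.connected_iff_exists_forall_reachable _).mpr ⟨Sum.inl a₀, ?_⟩
  rintro (a | b)
  · exact (hadj a₀ b₀).reachable.trans (hadj a b₀).reachable.symm
  · exact (hadj a₀ b).reachable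

theorem mainTheorem6_general {K V : Type*} [Field K] [CharZero K] [Finite V] {Γ : SimpleGraph V}
    [Fintype Γ.edgeSet] (hΓ : Γ.Connected) (hV : Nat.card V ≤ 5) :
    HasStrongLefschetzProperty (graphicComponent K Γ) ∧
      IsStrongLefschetzElement (graphicComponent K Γ) (Ideal.Quotient.mk _ (∑ e, X e)) := by
  classical
  have hsum : ∑ e : Γ.edgeSet, (X e : MvPolynomial Γ.edgeSet K) =
      ∑ e, (1 : Γ.edgeSet → K) e • X e := by simp only [Pi.one_apply, one_smul]
  rw [hsum]
  have hL := isStrongLefschetzElement_of_det_hessian_ne_zero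
    (isHomogeneous_kirchhoffPolynomial (K := K) (Γ := Γ)) (by omega)
    (eval_one_kirchhoffPolynomial_ne_zero hΓ)
    fun _ => det_hessian_kirchhoffPolynomial_ne_zero hΓ (by omega)
  exact ⟨⟨_, hL⟩, hL⟩

theorem mainTheorem6 (K : Type*) [Field K] [CharZero K] (m n : ℕ) (hm : 1 ≤ m) (hn : 1 ≤ n)
    (hmn : m + n ≤ 5) [Fintype (completeBipartiteGraph (Fin m) (Fin n)).edgeSet] :
    HasStrongLefschetzProperty (graphicComponent K (completeBipartiteGraph (Fin m) (Fin n))) ∧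
      IsStrongLefschetzElement (graphicComponent K (completeBipartiteGraph (Fin m) (Fin n)))
        (Ideal.Quotient.mk _ (∑ e, MvPolynomial.X e)) :=
  have := Fin.pos_iff_nonempty.mp hm
  have := Fin.pos_iff_nonempty.mp hn
  mainTheorem6_general connected_completeBipartiteGraph (by simpa using hmn)
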